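/- Let $Q(\mathbf A) :- R_1(\mathbb A_1),\dots,R_m(\mathbb A_m)$ be a conjunctive query without self-joins (the relation names $R_1,\dots,R_m$ are distinct), whose attribute set $\mathbb A=\bigcup_i\mathbb A_i$ is finite and non-empty and whose set of output attributes is an arbitrary $\mathbf A\subseteq\mathbb A$. For a database $D$, i.e. finite relations $R_i^D$ of tuples over $\mathbb A_i$ with values in $\mathbb N$, let $N=|D|=\sum_i|R_i^D|$, and let $Q(D)$ be the projection onto $\mathbf A$ of the natural join of all $R_i^D$. A witness for $D$ is a sub-database $D'\subseteq D$ with $Q(D')=Q(D)$, and a solution to $\mathrm{SWP}(Q,D)$ is a witness with the fewest tuples. A smallest witness for a single result $t\in Q(D)$ is a sub-database $D'\subseteq D$ with $t\in Q(D')$ and with the fewest tuples. Let $\rho^*$ be the fractional edge covering number of $Q$, i.e. the minimum of $\sum_{i}W(R_i)$ over all $W:\{R_1,\dots,R_m\}\to[0,1]$ such that $\sum_{i:A\in\mathbb A_i}W(R_i)\ge 1$ for every $A\in\mathbb A$. Then SWP for $Q$ is $O(N^{1-1/\rho^*})$-approximable, with a constant depending only on $Q$: there is an algorithm (depending only on $Q$)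 that, given any database $D$, computes in time polynomial in $N$ a witness $D'$ for $D$ with $$|D'|\le m\cdot N^{1-1/\rho^*}\cdot|D^*|,$$ where $D^*$ is a solution to $\mathrm{SWP}(Q,D)$. Moreover, for every database $D$, every union of one smallest witness for each query result $t\in Q(D)$ is a witness $D'$ that satisfies this inequality, and such a union can be computed in time polynomial in $N$. Here time is the number of steps of a uniform-cost random access machine whose words are natural numbers, whose only arithmetic operations are addition and truncated subtraction, and which receives and returns a database as an arbitrarily ordered list of its tuples without repetition, with one word for each value. -/

import Mathlib

namespace SWP

/-! ### Conjunctive queries without self-joins, databases, query results -/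

/-- A conjunctive query without self-joins `Q(head) :- R_0(attr 0), …, R_{m-1}(attr (m-1))` with
`m = numRel` distinct relation names, over the attributes `0, …, numAttr - 1`. Every attribute
occurs in the body, and the output attributes `head` are an arbitrary set of attributes. -/
structure CQ where
  numAttr : ℕ
  numRel : ℕ
  attr : Fin numRel → Finset (Fin numAttr)
  head : Finset (Fin numAttr)
  covered : ∀ A : Fin numAttr, ∃ i : Fin numRel, A ∈ attr i

/-- A tuple over a set `X` of attributes; domain values are natural numbers. -/
abbrev Tuple {k : ℕ} (X : Finset (Fin k)) : Type := {A : Fin k // A ∈ X} → ℕ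

/-- The projection `π_X t` of a tuple over all attributes. -/
def proj {k : ℕ} (X : Finset (Fin k)) (t : Fin k → ℕ) : Tuple X := fun A => t A.1

/-- A fact `R_i(t)`: a relation name together with a tuple over the attributes of that relation. -/
abbrev Fact (Q : CQ) : Type := (i : Fin Q.numRel) × Tuple (Q.attr i)

/-- A database is a finite set of facts; the relation `R_i` of `D` is `{t | ⟨i, t⟩ ∈ D}`, so the
input size `N = |D| = ∑ i, |R_i|` is `D.card`. -/
abbrev Database (Q : CQ) : Type := Finset (Fact Q)

/-- The query result `Q(D)`: the projection of the natural join of all relations to `head`. -/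
def CQ.result (Q : CQ) (D : Database Q) : Set (Tuple Q.head) :=
  {u | ∃ t : Fin Q.numAttr → ℕ, (∀ i, (⟨i, proj (Q.attr i) t⟩ : Fact Q) ∈ D) ∧ u = proj Q.head t}

/-! ### Fractional edge covering number -/

/-- Fractional edge coverings `W : rels(Q) → [0,1]`. -/
def CQ.IsFracEdgeCovering (Q : CQ) (W : Fin Q.numRel → ℝ) : Prop :=
  (∀ i, 0 ≤ W i ∧ W i ≤ 1) ∧
    ∀ A : Fin Q.numAttr, 1 ≤ ∑ i ∈ Finset.univ.filter (fun i => A ∈ Q.attr i), W i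

/-- The fractional edge covering number `ρ*`: the least total weight of a fractional edge covering
(the set below is non-empty and compact, so its infimum is a minimum). -/
noncomputable def CQ.fracEdgeCoverNumber (Q : CQ) : ℝ :=
  sInf {r : ℝ | ∃ W : Fin Q.numRel → ℝ, Q.IsFracEdgeCovering W ∧ r = ∑ i, W i}

/-! ### The smallest witness problem and its approximation -/

/-- `D'` is a witness for `Q` and `D`. -/
def IsWitness (Q : CQ) (D D' : Database Q) : Prop := D' ⊆ D ∧ Q.result D' = Q.result D

/-- `D'` is a solution to `SWP(Q, D)`, a witness with the fewest facts. -/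
def IsSmallestWitness (Q : CQ) (D D' : Database Q) : Prop :=
  IsWitness Q D D' ∧ ∀ D'', IsWitness Q D D'' → D'.card ≤ D''.card

/-- `D'` is a `θ`-approximated solution to `SWP(Q, D)`. -/
def IsApproxSolution (Q : CQ) (θ : ℝ) (D D' : Database Q) : Prop :=
  IsWitness Q D D' ∧
    ∃ Dopt, IsSmallestWitness Q D Dopt ∧ (D'.card : ℝ) ≤ θ * (Dopt.card : ℝ)

/-- `D'` is a solution to `SWP(Q, D, t)`, the smallest witness problem for one query result. -/
def IsSmallestWitnessFor (Q : CQ) (D : Database Q) (t : Tuple Q.head) (D' : Database Q) : Prop :=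
  (D' ⊆ D ∧ t ∈ Q.result D') ∧ ∀ D'', D'' ⊆ D → t ∈ Q.result D'' → D'.card ≤ D''.card

/-- `D'` is the union of one smallest witness `w t` for each query result `t ∈ Q(D)`. -/
def IsUnionOfSmallestWitnesses (Q : CQ) (D D' : Database Q) : Prop :=
  ∃ w : Tuple Q.head → Database Q,
    (∀ t ∈ Q.result D, IsSmallestWitnessFor Q D t (w t)) ∧
      ∀ f : Fact Q, f ∈ D' ↔ ∃ t ∈ Q.result D, f ∈ w t

/-! ### Machine model: uniform-cost random access machine

Words are natural numbers; the only arithmetic is addition and truncated subtraction, so that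
uniform-cost time is polynomially related to Turing machine time. -/

/-- A state of the machine: registers and memory. -/
structure State where
  reg : ℕ → ℕ
  mem : ℕ → ℕ

/-- Structured programs of the random access machine. -/
inductive Prog : Type
  /-- do nothing -/
  | skip : Prog
  /-- `reg r := c` -/
  | const (r c : ℕ) : Prog
  /-- `reg r := reg a + reg b` -/
  | add (r a b : ℕ) : Prog
  /-- `reg r := reg a - reg b` (truncated at `0`) -/
  | sub (r a b : ℕ) : Prog
  /-- `reg r := mem (reg a)` -/
  | load (r a : ℕ) : Prog
  /-- `mem (reg a) := reg r` -/
  | store (a r : ℕ) : Prog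
  /-- first `p`, then `q` -/
  | seq (p q : Prog) : Prog
  /-- `if reg r = 0 then p else q` -/
  | ifZero (r : ℕ) (p q : Prog) : Prog
  /-- `while reg r ≠ 0 do p` -/
  | loop (r : ℕ) (p : Prog) : Prog

/-- Assignment to a register. -/
def State.setReg (s : State) (r v : ℕ) : State := ⟨Function.update s.reg r v, s.mem⟩

/-- Assignment to a memory cell. -/
def State.setMem (s : State) (a v : ℕ) : State := ⟨s.reg, Function.update s.mem a v⟩

/-- `Run p s s' n`: started in the state `s`, the program `p` halts in the state `s'` after exactly
`n` steps. Every elementary instruction and every test costs one step. -/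
inductive Run : Prog → State → State → ℕ → Prop
  | skip (s : State) : Run Prog.skip s s 1
  | const (r c : ℕ) (s : State) : Run (Prog.const r c) s (s.setReg r c) 1
  | add (r a b : ℕ) (s : State) : Run (Prog.add r a b) s (s.setReg r (s.reg a + s.reg b)) 1
  | sub (r a b : ℕ) (s : State) : Run (Prog.sub r a b) s (s.setReg r (s.reg a - s.reg b)) 1
  | load (r a : ℕ) (s : State) : Run (Prog.load r a) s (s.setReg r (s.mem (s.reg a))) 1
  | store (a r : ℕ) (s : State) : Run (Prog.store a r) s (s.setMem (s.reg a) (s.reg r)) 1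
  | seq {p q : Prog} {s s₁ s₂ : State} {n₁ n₂ : ℕ} :
      Run p s s₁ n₁ → Run q s₁ s₂ n₂ → Run (Prog.seq p q) s s₂ (n₁ + n₂)
  | ifZero_true {r : ℕ} {p q : Prog} {s s' : State} {n : ℕ} :
      s.reg r = 0 → Run p s s' n → Run (Prog.ifZero r p q) s s' (n + 1)
  | ifZero_false {r : ℕ} {p q : Prog} {s s' : State} {n : ℕ} :
      s.reg r ≠ 0 → Run q s s' n → Run (Prog.ifZero r p q) s s' (n + 1)
  | loop_done {r : ℕ} {p : Prog} {s : State} : s.reg r = 0 → Run (Prog.loop r p) s s 1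
  | loop_step {r : ℕ} {p : Prog} {s s₁ s₂ : State} {n₁ n₂ : ℕ} :
      s.reg r ≠ 0 → Run p s s₁ n₁ → Run (Prog.loop r p) s₁ s₂ n₂ →
        Run (Prog.loop r p) s s₂ (n₁ + n₂ + 1)

/-- The state `s` holds the database `D`: register `0` contains `|D|`, and the memory from address
`0` on contains the facts of `D`, listed without repetition in some order. Each fact is a record of
`1 + numAttr` words: the number of its relation, then for each attribute `A` one word, which is the
value of the tuple at `A` if `A` is an attribute of the relation, and arbitrary otherwise. The other
registers and memory cells are arbitrary. -/
def Holds (Q : CQ) (s : State) (D : Database Q) : Prop :=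
  ∃ l : List (Fact Q), l.Nodup ∧ l.toFinset = D ∧ s.reg 0 = l.length ∧
    ∀ (j : ℕ) (hj : j < l.length),
      s.mem (j * (1 + Q.numAttr)) = (l[j].1 : ℕ) ∧
        ∀ A : {A : Fin Q.numAttr // A ∈ Q.attr l[j].1},
          s.mem (j * (1 + Q.numAttr) + 1 + (A.1 : ℕ)) = l[j].2 A

/-- The search problem "given `D`, find some `D'` with `Spec D D'`" is solved by a program of the
random access machine in a number of steps that is polynomial in `|D|`. The program may depend on
the query (data complexity), but on nothing else. -/
def SolvableInPolyTime (Q : CQ) (Spec : Database Q → Database Q → Prop) : Prop :=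
  ∃ (P : Prog) (p : Polynomial ℕ), ∀ (D : Database Q) (s : State), Holds Q s D →
    ∃ (s' : State) (n : ℕ) (D' : Database Q),
      Run P s s' n ∧ n ≤ p.eval D.card ∧ Holds Q s' D' ∧ Spec D D'

/-- `SWP` is `θ`-approximable for `Q`, where the ratio `θ` is a function of `N = |D|`. -/
def IsApproximable (Q : CQ) (θ : ℕ → ℝ) : Prop :=
  SolvableInPolyTime Q fun D D' => IsApproxSolution Q (θ D.card) D D'

/-- The ratio `|rels(Q)| · N^(1 - 1/ρ*)`. -/
noncomputable def CQ.ratio (Q : CQ) (N : ℕ) : ℝ :=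
  (Q.numRel : ℝ) * (N : ℝ) ^ (1 - 1 / Q.fracEdgeCoverNumber)

end SWP

/-! Approximation. A witness for one result contains a fact of each of the `m` relations, and the
`m` facts of any full tuple projecting to that result suffice, so smallest witnesses of single
results have exactly `m` facts. A union `D'` of them is contained in `D`, hence `|D'| ≤ m * M` with
`M = min N |Q(D)|`. An optimal witness `D*` has the same results as `D`, so the Atserias–Grohe–Marx
bound applied to `D*` gives `M ≤ |D*| ^ ρ*`. Splitting `M = M ^ (1 - 1/ρ*) * M ^ (1/ρ*)`, with `M ≤
N` in the first factor and this bound in the second, gives the ratio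
(`IsUnionOfSmallestWitnesses.isApproxSolution`). The bound itself is an induction on attributes
(`card_image_mask_le`) driven by a Hölder inequality (`sum_prod_rpow_le`).

Computation. An inclusion-minimal witness is already such a union
(`isUnionOfSmallestWitnesses_of_minimal`): a fact outside the chosen witnesses of all results could
be deleted. So it suffices to delete redundant facts greedily, and one pass is enough because a fact
that is not redundant stays so after redundant ones are removed (`CQ.result_erase_ne`). Redundancy
is a first-order condition on `2 * m` records; as `m` is fixed by the query, nested loops decide it
in polynomial time (`polyDecidable_redundant`). -/

namespace SWP

/-! ### The bound of Atserias, Grohe and Marx -/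

section AGM

variable {α ι : Type*}

/-- A form of Hölder's inequality in which some factors are merely bounded. -/
theorem sum_prod_rpow_le {κ : Type*} [Fintype ι] (s : Finset κ) (I : Finset ι) (W X : ι → ℝ)
    (x : ι → κ → ℝ) (hW : ∀ i, 0 ≤ W i) (hX : ∀ i, 0 < X i) (hx : ∀ i a, 0 ≤ x i a)
    (hI : 1 ≤ ∑ i ∈ I, W i) (hsum : ∀ i ∈ I, ∑ a ∈ s, x i a ≤ X i)
    (hle : ∀ i, ∀ a ∈ s, x i a ≤ X i) :
    ∑ a ∈ s, ∏ i, x i a ^ W i ≤ ∏ i, X i ^ W i := by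
  set σ := ∑ i ∈ I, W i with hσ
  have hσ0 : 0 < σ := lt_of_lt_of_le one_pos hI
  have hP : 0 < ∏ i, X i ^ W i := Finset.prod_pos fun i _ => Real.rpow_pos_of_pos (hX i) _
  have h01 : ∀ i a, 0 ≤ x i a / X i := fun i a => div_nonneg (hx i a) (hX i).le
  -- After normalization all factors lie in `[0, 1]`: factors outside `I` can be dropped, and
  -- dividing the exponents by `σ ≥ 1` only increases the product. The new exponents sum to `1`, as
  -- weighted AM-GM requires.
  have key : ∀ a ∈ s, ∏ i, (x i a / X i) ^ W i ≤ ∑ i ∈ I, W i / σ * (x i a / X i) := by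
    intro a ha
    have h1 : ∀ i, x i a / X i ≤ 1 := fun i => (div_le_one (hX i)).2 (hle i a ha)
    calc ∏ i, (x i a / X i) ^ W i
        ≤ ∏ i ∈ I, (x i a / X i) ^ W i := by
          classical
          rw [← Finset.prod_mul_prod_compl I]
          exact mul_le_of_le_one_right (Finset.prod_nonneg fun i _ => Real.rpow_nonneg (h01 i a) _)
            (Finset.prod_le_one (fun i _ => Real.rpow_nonneg (h01 i a) _)
              fun i _ => Real.rpow_le_one (h01 i a) (h1 i) (hW i))
      _ ≤ ∏ i ∈ I, (x i a / X i) ^ (W i / σ) := by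
          refine Finset.prod_le_prod (fun i _ => Real.rpow_nonneg (h01 i a) _) fun i _ => ?_
          rcases (hW i).eq_or_lt with h | h
          · simp [← h]
          · exact Real.rpow_le_rpow_of_exponent_ge_of_imp (h01 i a) (h1 i)
              (div_le_self (hW i) hI) (fun _ h0 => absurd h0 h.ne')
      _ ≤ ∑ i ∈ I, W i / σ * (x i a / X i) :=
          Real.geom_mean_le_arith_mean_weighted I _ _ (fun i _ => div_nonneg (hW i) hσ0.le)
            (by rw [← Finset.sum_div, div_self hσ0.ne']) (fun i _ => h01 i a)
  have hone : ∑ a ∈ s, ∏ i, (x i a / X i) ^ W i ≤ 1 := by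
    calc ∑ a ∈ s, ∏ i, (x i a / X i) ^ W i
        ≤ ∑ a ∈ s, ∑ i ∈ I, W i / σ * (x i a / X i) := Finset.sum_le_sum key
      _ = ∑ i ∈ I, W i / σ * ((∑ a ∈ s, x i a) / X i) := by
          rw [Finset.sum_comm]
          refine Finset.sum_congr rfl fun i _ => ?_
          rw [Finset.sum_div, Finset.mul_sum]
      _ ≤ ∑ i ∈ I, W i / σ := Finset.sum_le_sum fun i hi =>
          mul_le_of_le_one_right (div_nonneg (hW i) hσ0.le) ((div_le_one (hX i)).2 (hsum i hi))
      _ = 1 := by rw [← Finset.sum_div, div_self hσ0.ne']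
  calc ∑ a ∈ s, ∏ i, x i a ^ W i
      = (∑ a ∈ s, ∏ i, (x i a / X i) ^ W i) * ∏ i, X i ^ W i := by
        rw [Finset.sum_mul]
        refine Finset.sum_congr rfl fun a _ => ?_
        rw [← Finset.prod_mul_distrib]
        refine Finset.prod_congr rfl fun i _ => ?_
        rw [← Real.mul_rpow (h01 i a) (hX i).le, div_mul_cancel₀ _ (hX i).ne']
    _ ≤ ∏ i, X i ^ W i := mul_le_of_le_one_left hP.le hone

variable [DecidableEq α]

/-- The projection to `S`, encoded by setting all other coordinates to `0`. -/
def mask (S : Finset α) (t : α → ℕ) : α → ℕ := fun A => if A ∈ S then t A else 0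

theorem mask_eq_mask_iff {S : Finset α} {t u : α → ℕ} :
    mask S t = mask S u ↔ ∀ A ∈ S, t A = u A := by
  refine ⟨fun h A hA => ?_, fun h => funext fun A => ?_⟩
  · simpa [mask, hA] using congrFun h A
  · by_cases hA : A ∈ S <;> simp [mask, hA, h]

variable [Fintype α]

/-- Fibre the projection over its coordinate at `A`: within one fibre that coordinate is constant,
so forgetting it is injective. -/
theorem card_image_mask_insert (F : Finset (α → ℕ)) {S : Finset α} {A : α} (hA : A ∉ S) :
    (F.image (mask (insert A S))).card =
      ∑ a ∈ F.image (fun t => t A), ((F.filter fun t => t A = a).image (mask S)).card := by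
  have hm : ∀ t, mask (insert A S) t A = t A := fun t => by simp [mask]
  have hmm : ∀ t, mask S (mask (insert A S) t) = mask S t := fun t =>
    mask_eq_mask_iff.2 fun B hB => by simp [mask, hB]
  rw [Finset.card_eq_sum_card_fiberwise (f := fun t => t A) (t := F.image (fun t => t A))]
  · refine Finset.sum_congr rfl fun a _ => ?_
    have : (F.filter fun t => t A = a).image (mask S) =
        ((F.image (mask (insert A S))).filter fun t => t A = a).image (mask S) := by
      ext u
      simp only [Finset.mem_image, Finset.mem_filter]
      constructor
      · rintro ⟨t, ⟨ht, hta⟩, rfl⟩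
        exact ⟨_, ⟨⟨t, ht, rfl⟩, by rw [hm, hta]⟩, hmm t⟩
      · rintro ⟨_, ⟨⟨t, ht, rfl⟩, hta⟩, rfl⟩
        exact ⟨t, ⟨ht, by rw [← hm t, hta]⟩, (hmm t).symm⟩
    rw [this, Finset.card_image_of_injOn]
    intro u hu v hv huv
    simp only [Finset.coe_filter, Finset.mem_image, Set.mem_ofPred_eq] at hu hv
    obtain ⟨⟨t, -, rfl⟩, hu⟩ := hu
    obtain ⟨⟨t', -, rfl⟩, hv⟩ := hv
    rw [hmm, hmm, mask_eq_mask_iff] at huv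
    rw [mask_eq_mask_iff]
    intro B hB
    rcases Finset.mem_insert.1 hB with rfl | hB
    · rw [← hm t, ← hm t', hu, hv]
    · exact huv B hB
  · intro u hu
    obtain ⟨t, ht, rfl⟩ := Finset.mem_image.1 hu
    exact Finset.mem_image.2 ⟨t, ht, (hm t).symm⟩

/-- Induction on `S`, for all `F` at once: fixing the value at a new attribute `A` restricts `F` to
a fibre, to which the induction hypothesis applies. Summing over the fibres is the Hölder step,
where the covering condition at `A` is used. -/
theorem card_image_mask_le [Fintype ι] (X : ι → Finset α) (W : ι → ℝ) (hW : ∀ i, 0 ≤ W i)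
    (hcov : ∀ A, 1 ≤ ∑ i ∈ Finset.univ.filter (fun i => A ∈ X i), W i) (S : Finset α) :
    ∀ F : Finset (α → ℕ), ((F.image (mask S)).card : ℝ) ≤
      ∏ i, ((F.image (mask (X i ∩ S))).card : ℝ) ^ W i := by
  induction S using Finset.induction_on with
  | empty =>
    intro F
    rcases F.eq_empty_or_nonempty with rfl | hF
    · simpa using Finset.prod_nonneg fun i _ => Real.rpow_nonneg (le_refl (0 : ℝ)) (W i)
    · have h1 : (F.image (mask (∅ : Finset α))).card ≤ 1 := by
        rw [Finset.card_le_one]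
        intro u hu v hv
        obtain ⟨t, -, rfl⟩ := Finset.mem_image.1 hu
        obtain ⟨t', -, rfl⟩ := Finset.mem_image.1 hv
        simp [mask_eq_mask_iff]
      calc ((F.image (mask (∅ : Finset α))).card : ℝ) ≤ 1 := by exact_mod_cast h1
        _ = ∏ _i : ι, (1 : ℝ) := by simp
        _ ≤ _ := Finset.prod_le_prod (fun _ _ => zero_le_one) fun i _ => Real.one_le_rpow
              (by exact_mod_cast (hF.image _).card_pos) (hW i)
  | insert A S hA ih =>
    intro F
    rcases F.eq_empty_or_nonempty with rfl | hF
    · simpa using Finset.prod_nonneg fun i _ => Real.rpow_nonneg (le_refl (0 : ℝ)) (W i)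
    rw [card_image_mask_insert F hA]
    rw [Nat.cast_sum]
    refine (Finset.sum_le_sum fun a _ => ih (F.filter fun t => t A = a)).trans ?_
    have hpos : ∀ i, (0 : ℝ) < ((F.image (mask (X i ∩ insert A S))).card : ℝ) := fun i =>
      Nat.cast_pos.2 (hF.image _).card_pos
    have hx : ∀ i a,
        (0 : ℝ) ≤ (((F.filter fun t => t A = a).image (mask (X i ∩ S))).card : ℝ) :=
      fun i a => Nat.cast_nonneg _
    -- For `X i` containing `A` the fibre counts add up to the whole count; for the others each
    -- fibre count is merely bounded by it.
    refine sum_prod_rpow_le (F.image fun t => t A) (Finset.univ.filter fun i => A ∈ X i) W _ _ hW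
      hpos hx (hcov A) ?_ ?_
    · intro i hi
      rw [Finset.inter_insert_of_mem (Finset.mem_filter.1 hi).2,
        card_image_mask_insert F (by simp [hA])]
      push_cast
      exact le_rfl
    · intro i a ha
      norm_cast
      by_cases hi : A ∈ X i
      · rw [Finset.inter_insert_of_mem hi, card_image_mask_insert F (by simp [hA])]
        exact Finset.single_le_sum
          (f := fun a => ((F.filter fun t => t A = a).image (mask (X i ∩ S))).card)
          (fun _ _ => Nat.zero_le _) ha
      · rw [Finset.inter_insert_of_notMem hi]
        exact Finset.card_le_card (Finset.image_subset_image (Finset.filter_subset _ _))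

end AGM

/-! ### Query results and smallest witnesses -/

section Witness

variable {Q : CQ}

theorem CQ.result_mono {D D' : Database Q} (h : D ⊆ D') : Q.result D ⊆ Q.result D' := by
  rintro _ ⟨t, ht, rfl⟩
  exact ⟨t, fun i => h (ht i), rfl⟩

/-- The facts that make up a tuple over all attributes. -/
def CQ.factsOf (Q : CQ) (t : Fin Q.numAttr → ℕ) : Database Q :=
  Finset.univ.map ⟨fun i => (⟨i, proj (Q.attr i) t⟩ : Fact Q), fun _ _ h => congrArg Sigma.fst h⟩

theorem CQ.card_factsOf (t : Fin Q.numAttr → ℕ) : (Q.factsOf t).card = Q.numRel := by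
  simp [CQ.factsOf]

theorem CQ.factsOf_subset {t : Fin Q.numAttr → ℕ} {D : Database Q} :
    Q.factsOf t ⊆ D ↔ ∀ i, (⟨i, proj (Q.attr i) t⟩ : Fact Q) ∈ D := by
  simp only [CQ.factsOf, Finset.subset_iff, Finset.mem_map, Finset.mem_univ, true_and,
    forall_exists_index, forall_apply_eq_imp_iff]
  exact Iff.rfl

theorem CQ.mem_result_iff {D : Database Q} {u : Tuple Q.head} :
    u ∈ Q.result D ↔ ∃ t, Q.factsOf t ⊆ D ∧ u = proj Q.head t := by
  simp only [CQ.factsOf_subset]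
  rfl

theorem CQ.numRel_le_card {D : Database Q} {u : Tuple Q.head} (h : u ∈ Q.result D) :
    Q.numRel ≤ D.card := by
  obtain ⟨t, ht, -⟩ := CQ.mem_result_iff.1 h
  exact (CQ.card_factsOf t).symm.le.trans (Finset.card_le_card ht)

/-- Optimality is a count: any sub-database producing a result has a fact for each of the distinct
relation names. -/
theorem isSmallestWitnessFor_factsOf {D : Database Q} {t : Fin Q.numAttr → ℕ}
    (h : Q.factsOf t ⊆ D) : IsSmallestWitnessFor Q D (proj Q.head t) (Q.factsOf t) :=
  ⟨⟨h, CQ.mem_result_iff.2 ⟨t, subset_rfl, rfl⟩⟩, fun _ _ h' =>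
    (CQ.card_factsOf t).le.trans (CQ.numRel_le_card h')⟩

theorem IsSmallestWitnessFor.card_le {D D' : Database Q} {u : Tuple Q.head}
    (h : IsSmallestWitnessFor Q D u D') : D'.card ≤ Q.numRel := by
  obtain ⟨t, ht, rfl⟩ := CQ.mem_result_iff.1 (CQ.result_mono h.1.1 h.1.2)
  exact (h.2 _ ht (CQ.mem_result_iff.2 ⟨t, subset_rfl, rfl⟩)).trans (CQ.card_factsOf t).le

theorem IsUnionOfSmallestWitnesses.isWitness {D D' : Database Q}
    (h : IsUnionOfSmallestWitnesses Q D D') : IsWitness Q D D' := by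
  obtain ⟨w, hw, hD'⟩ := h
  have hsub : D' ⊆ D := fun f hf => by
    obtain ⟨t, ht, hf⟩ := (hD' f).1 hf
    exact (hw t ht).1.1 hf
  exact ⟨hsub, (CQ.result_mono hsub).antisymm fun t ht =>
    CQ.result_mono (fun f hf => (hD' f).2 ⟨t, ht, hf⟩) (hw t ht).1.2⟩

/-- A witness from which no fact can be removed is a union of smallest witnesses. -/
theorem isUnionOfSmallestWitnesses_of_minimal {D D' : Database Q} (h : IsWitness Q D D')
    (hmin : ∀ f ∈ D', Q.result (D'.erase f) ≠ Q.result D') :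
    IsUnionOfSmallestWitnesses Q D D' := by
  classical
  have hex : ∀ u : Tuple Q.head, ∃ t, u ∈ Q.result D → Q.factsOf t ⊆ D' ∧ u = proj Q.head t := by
    intro u
    by_cases hu : u ∈ Q.result D
    · obtain ⟨t, ht⟩ := CQ.mem_result_iff.1 (h.2.symm ▸ hu)
      exact ⟨t, fun _ => ht⟩
    · exact ⟨0, fun h => absurd h hu⟩
  choose T hT using hex
  refine ⟨fun u => Q.factsOf (T u), fun u hu => ?_, fun f => ⟨fun hf => ?_, ?_⟩⟩
  · have := isSmallestWitnessFor_factsOf ((hT u hu).1.trans h.1)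
    rwa [← (hT u hu).2] at this
  -- If `f` lies in none of the chosen witnesses, all of them survive its deletion, contrary to
  -- minimality.
  · by_contra hno
    refine hmin f hf ((CQ.result_mono (Finset.erase_subset _ _)).antisymm fun u hu => ?_)
    have hu' : u ∈ Q.result D := h.2 ▸ hu
    refine CQ.mem_result_iff.2 ⟨T u, fun g hg => Finset.mem_erase.2 ⟨?_, (hT u hu').1 hg⟩,
      (hT u hu').2⟩
    rintro rfl
    exact hno ⟨u, hu', hg⟩
  · rintro ⟨u, hu, hf⟩
    exact (hT u hu).1 hf

theorem exists_isSmallestWitness (Q : CQ) (D : Database Q) : ∃ D', IsSmallestWitness Q D D' := by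
  classical
  obtain ⟨D', hD', hmin⟩ := Finset.exists_min_image
    (D.powerset.filter fun D' => Q.result D' = Q.result D) Finset.card
    ⟨D, by simp⟩
  simp only [Finset.mem_filter, Finset.mem_powerset] at hD' hmin
  exact ⟨D', hD', hmin⟩

/-- A full tuple is determined by its facts, since every attribute occurs in some relation; so
results inject into `m`-tuples of facts of `D`. -/
theorem CQ.finite_result (D : Database Q) : (Q.result D).Finite := by
  choose T hT hTu using fun u : Q.result D => u.2
  refine @Set.toFinite _ _ (Finite.of_injective
    (fun u : Q.result D => fun i => (⟨_, hT u i⟩ : {f // f ∈ D})) fun u v huv => ?_)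
  have hA : T u = T v := funext fun A => by
    obtain ⟨i, hi⟩ := Q.covered A
    have := congrArg Subtype.val (congrFun huv i)
    exact congrFun (eq_of_heq (Sigma.mk.inj this).2) ⟨A, hi⟩
  exact Subtype.ext ((hTu u).trans (hA ▸ (hTu v).symm))

/-- The number of query results is at most `|D| ^ r` if there is a fractional edge covering of
total weight `r`. -/
theorem CQ.ncard_result_le (D : Database Q) {W : Fin Q.numRel → ℝ}
    (hW : Q.IsFracEdgeCovering W) (hm : 0 < Q.numRel) :
    ((Q.result D).ncard : ℝ) ≤ (D.card : ℝ) ^ ∑ i, W i := by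
  classical
  -- One full tuple per result is kept instead of the whole join. Thus a covering of all attributes
  -- bounds the number of results for any head.
  choose! T hT hTu using fun u (hu : u ∈ Q.result D) => hu
  set F : Finset (Fin Q.numAttr → ℕ) := (CQ.finite_result D).toFinset.image T with hF
  have hFD : ∀ t ∈ F, ∀ i, (⟨i, proj (Q.attr i) t⟩ : Fact Q) ∈ D := by
    intro t ht
    obtain ⟨u, hu, rfl⟩ := Finset.mem_image.1 ht
    exact hT u ((CQ.finite_result D).mem_toFinset.1 hu)
  have hcard : (Q.result D).ncard = F.card := by
    rw [hF, Finset.card_image_of_injOn, Set.ncard_eq_toFinset_card _ (CQ.finite_result D)]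
    intro u hu v hv huv
    rw [hTu u (by simpa using hu), hTu v (by simpa using hv), huv]
  have huniv : F.image (mask Finset.univ) = F := by
    have : mask (Finset.univ : Finset (Fin Q.numAttr)) = id := by
      funext t A
      simp [mask]
    rw [this, Finset.image_id]
  have hagm := card_image_mask_le Q.attr W (fun i => (hW.1 i).1) hW.2 Finset.univ F
  rw [huniv] at hagm
  rcases Nat.eq_zero_or_pos D.card with h0 | hpos
  · have : (Q.result D).ncard = 0 := by
      rw [Set.ncard_eq_zero (CQ.finite_result D), Set.eq_empty_iff_forall_notMem]
      intro u hu
      have := CQ.numRel_le_card hu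
      omega
    rw [this, Nat.cast_zero]
    positivity
  rw [hcard, Real.rpow_sum_of_pos (by exact_mod_cast hpos)]
  refine hagm.trans (Finset.prod_le_prod (fun i _ => by positivity) fun i _ =>
    Real.rpow_le_rpow (by positivity) ?_ (hW.1 i).1)
  norm_cast
  rw [Finset.inter_univ]
  -- Each masked tuple is read off from a fact of `D`, so the size of the whole database bounds
  -- every factor.
  have : F.image (mask (Q.attr i)) ⊆ D.image
      fun f A => if h : f.1 = i ∧ A ∈ Q.attr f.1 then f.2 ⟨A, h.2⟩ else 0 := by
    intro v hv
    obtain ⟨t, ht, rfl⟩ := Finset.mem_image.1 hv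
    refine Finset.mem_image.2 ⟨_, hFD t ht i, funext fun A => ?_⟩
    by_cases h : A ∈ Q.attr i <;> simp [mask, proj, h]
  exact (Finset.card_le_card this).trans Finset.card_image_le

/-! ### The exponent `ρ*` and the approximation ratio -/

theorem CQ.numRel_pos (hQ : 0 < Q.numAttr) : 0 < Q.numRel :=
  let ⟨i, _⟩ := Q.covered ⟨0, hQ⟩
  i.pos

theorem CQ.isFracEdgeCovering_one : Q.IsFracEdgeCovering 1 := by
  refine ⟨fun i => by simp, fun A => ?_⟩
  obtain ⟨i, hi⟩ := Q.covered A
  simp only [Pi.one_apply, Finset.sum_const, nsmul_eq_mul, mul_one]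
  exact_mod_cast Finset.card_pos.2 ⟨i, by simp [hi]⟩

theorem CQ.one_le_fracEdgeCoverNumber (hQ : 0 < Q.numAttr) : 1 ≤ Q.fracEdgeCoverNumber := by
  refine le_csInf ⟨_, 1, CQ.isFracEdgeCovering_one, rfl⟩ ?_
  rintro _ ⟨W, hW, rfl⟩
  exact (hW.2 ⟨0, hQ⟩).trans
    (Finset.sum_le_sum_of_subset_of_nonneg (Finset.subset_univ _) fun i _ _ => (hW.1 i).1)

/-- The number of query results is at most `|D| ^ ρ*`. -/
theorem CQ.ncard_result_le_rpow (hQ : 0 < Q.numAttr) (D : Database Q) :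
    ((Q.result D).ncard : ℝ) ≤ (D.card : ℝ) ^ Q.fracEdgeCoverNumber := by
  have hm := CQ.numRel_pos hQ
  rcases Nat.eq_zero_or_pos (Q.result D).ncard with h0 | hT
  · rw [h0, Nat.cast_zero]
    positivity
  obtain ⟨u, hu⟩ := Set.nonempty_of_ncard_ne_zero hT.ne'
  have hn : 1 ≤ D.card := hm.trans_le (CQ.numRel_le_card hu)
  have hle := fun W hW => CQ.ncard_result_le D (W := W) hW hm
  -- Base `1` is excluded before taking logarithms. The logarithm of the result count is then a
  -- lower bound for all covering weights, so it need not be known that the infimum is attained.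
  rcases hn.eq_or_lt with h1 | h1
  · simpa [← h1] using hle 1 CQ.isFracEdgeCovering_one
  have hD : (1 : ℝ) < D.card := by exact_mod_cast h1
  have hT' : (0 : ℝ) < (Q.result D).ncard := by exact_mod_cast hT
  rw [← Real.logb_le_iff_le_rpow hD hT']
  refine le_csInf ⟨_, 1, CQ.isFracEdgeCovering_one, rfl⟩ ?_
  rintro _ ⟨W, hW, rfl⟩
  exact (Real.logb_le_iff_le_rpow hD hT').2 (hle W hW)

theorem IsUnionOfSmallestWitnesses.card_le {D D' : Database Q}
    (h : IsUnionOfSmallestWitnesses Q D D') : D'.card ≤ Q.numRel * (Q.result D).ncard := by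
  classical
  obtain ⟨w, hw, hD'⟩ := h
  have : D' = (CQ.finite_result D).toFinset.biUnion w := by
    ext f
    simp [hD']
  rw [this, Set.ncard_eq_toFinset_card _ (CQ.finite_result D), mul_comm]
  exact Finset.card_biUnion_le_card_mul _ _ _ fun u hu => (hw u (by simpa using hu)).card_le

theorem IsUnionOfSmallestWitnesses.isApproxSolution (hQ : 0 < Q.numAttr) {D D' : Database Q}
    (h : IsUnionOfSmallestWitnesses Q D D') : IsApproxSolution Q (Q.ratio D.card) D D' := by
  obtain ⟨Dopt, hopt⟩ := exists_isSmallestWitness Q D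
  refine ⟨h.isWitness, Dopt, hopt, ?_⟩
  set ρ := Q.fracEdgeCoverNumber with hρ
  have hρ1 : 1 ≤ ρ := CQ.one_le_fracEdgeCoverNumber hQ
  have hρ0 : 0 < ρ := one_pos.trans_le hρ1
  have hα : 0 ≤ 1 - 1 / ρ := sub_nonneg.2 ((div_le_one hρ0).2 hρ1)
  have hm := CQ.numRel_pos hQ
  -- The minimum serves both factors below: `M ≤ N` bounds one power, `M ≤ |Q(D)|` the other.
  set M := min D.card (Q.result D).ncard with hM
  have hcard : D'.card ≤ Q.numRel * M := by
    rw [hM, ← Nat.mul_min_mul_left]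
    exact le_min ((Finset.card_le_card h.isWitness.1).trans (Nat.le_mul_of_pos_left _ hm)) h.card_le
  have hagm := CQ.ncard_result_le_rpow hQ Dopt
  rw [hopt.1.2] at hagm
  have hMopt : (M : ℝ) ^ (1 / ρ) ≤ Dopt.card := by
    have hMle : (M : ℝ) ≤ (Dopt.card : ℝ) ^ ρ :=
      le_trans (by exact_mod_cast min_le_right _ _) hagm
    calc (M : ℝ) ^ (1 / ρ) ≤ ((Dopt.card : ℝ) ^ ρ) ^ (1 / ρ) :=
          Real.rpow_le_rpow (by positivity) hMle (by positivity)
      _ = Dopt.card := by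
          rw [← Real.rpow_mul (by positivity), mul_one_div_cancel hρ0.ne', Real.rpow_one]
  calc (D'.card : ℝ) ≤ Q.numRel * M := by exact_mod_cast hcard
    _ = Q.numRel * ((M : ℝ) ^ (1 - 1 / ρ) * (M : ℝ) ^ (1 / ρ)) := by
        -- Here `M` may be `0`; the exponents have nonzero sum `1`, so the powers still combine.
        rw [← Real.rpow_add' (by positivity) (by simp), sub_add_cancel, Real.rpow_one]
    _ ≤ Q.numRel * ((D.card : ℝ) ^ (1 - 1 / ρ) * Dopt.card) := by
        gcongr
        exact min_le_left _ _
    _ = Q.ratio D.card * Dopt.card := by rw [CQ.ratio, mul_assoc]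

end Witness

/-! ### Programming the random access machine -/

section Machine

/-- A rule for loops whose test register vanishes when the measure `k` of the invariant does. -/
theorem Run.exists_loop {r B : ℕ} {p : Prog} (Inv : ℕ → State → Prop)
    (h0 : ∀ s, Inv 0 s → s.reg r = 0)
    (hs : ∀ k s, Inv (k + 1) s → s.reg r ≠ 0 ∧
      ∃ s' n k', Run p s s' n ∧ n ≤ B ∧ k' ≤ k ∧ Inv k' s') :
    ∀ k s, Inv k s → ∃ s' n, Run (Prog.loop r p) s s' n ∧ n ≤ k * (B + 1) + 1 ∧ Inv 0 s' := by
  intro k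
  induction k using Nat.strong_induction_on with
  | _ k ih =>
    intro s hk
    rcases k with _ | k
    · exact ⟨s, 1, Run.loop_done (h0 s hk), by omega, hk⟩
    · obtain ⟨hr, s₁, n₁, k', hrun, hn, hk', hinv⟩ := hs k s hk
      obtain ⟨s₂, n₂, hrun₂, hn₂, hinv₂⟩ := ih k' (by omega) s₁ hinv
      refine ⟨s₂, n₁ + n₂ + 1, Run.loop_step hr hrun hrun₂, ?_, hinv₂⟩
      have := Nat.mul_le_mul_right (B + 1) hk'
      rw [Nat.add_mul]
      omega

/-- Coefficients are natural numbers. This bounds the cost of a test on the shrinking list by its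
value at the original size. -/
theorem polynomial_eval_mono (p : Polynomial ℕ) {a b : ℕ} (h : a ≤ b) : p.eval a ≤ p.eval b := by
  induction p using Polynomial.induction_on' with
  | add p q hp hq => simpa using Nat.add_le_add hp hq
  | monomial n c => simpa using Nat.mul_le_mul_left c (Nat.pow_le_pow_left h n)

/-- A predicate of the values of variables, the memory and the number of records. -/
abbrev Pred : Type := (ℕ → ℕ) → (ℕ → ℕ) → ℕ → Prop

/-- The values of the variables: variable `i` is kept in register `4 + i`. -/
def State.env (s : State) : ℕ → ℕ := fun i => s.reg (4 + i)

/-- Variables live in registers disjoint from the size register `0` and the scratch registers `1`,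
`2`, `3`; this is fed to `simp`. -/
theorem four_add_ne (i : ℕ) : (4 + i ≠ 0 ∧ 4 + i ≠ 1 ∧ 4 + i ≠ 2 ∧ 4 + i ≠ 3) ∧
    0 ≠ 4 + i ∧ 1 ≠ 4 + i ∧ 2 ≠ 4 + i ∧ 3 ≠ 4 + i := by
  omega

/-- The machine can decide the predicate `φ` of the first `n` variables in polynomial time, given
that variable `0` is the end address of `N` records of length `w`. The answer is returned in
register `1`. The memory, the variables and register `0` are preserved. -/
def PolyDecidable (w n : ℕ) (φ : Pred) : Prop :=
  (∀ e e' mem N, (∀ i < n, e i = e' i) → (φ e mem N ↔ φ e' mem N)) ∧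
  ∃ (P : Prog) (p : Polynomial ℕ), ∀ (s : State) (N : ℕ), s.env 0 = N * w →
    ∃ s' t, Run P s s' t ∧ t ≤ p.eval N ∧ s'.mem = s.mem ∧ s'.reg 0 = s.reg 0 ∧
      (∀ i < n, s'.env i = s.env i) ∧
      (φ s.env s.mem N ∧ s'.reg 1 = 1 ∨ ¬ φ s.env s.mem N ∧ s'.reg 1 = 0)

namespace PolyDecidable

variable {w n : ℕ} {φ ψ : Pred}

theorem of_iff (h : PolyDecidable w n φ) (hi : ∀ e mem N, ψ e mem N ↔ φ e mem N) :
    PolyDecidable w n ψ := by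
  have : ψ = φ := funext fun e => funext fun mem => funext fun N => propext (hi e mem N)
  rwa [this]

/-- Compare registers `2` and `3`. -/
def eqTest : Prog :=
  .seq (.sub 1 2 3) (.seq (.sub 2 3 2) (.seq (.add 1 1 2) (.ifZero 1 (.const 1 1) (.const 1 0))))

/-- The two truncated differences both vanish exactly when the numbers agree, so their sum tests
equality. -/
theorem run_eqTest (s : State) : ∃ s' t, Run eqTest s s' t ∧ t ≤ 5 ∧ s'.mem = s.mem ∧
    (∀ r, r ≠ 1 → r ≠ 2 → s'.reg r = s.reg r) ∧
    (s.reg 2 = s.reg 3 ∧ s'.reg 1 = 1 ∨ s.reg 2 ≠ s.reg 3 ∧ s'.reg 1 = 0) := by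
  by_cases h : s.reg 2 = s.reg 3
  · refine ⟨_, _, .seq (.sub _ _ _ _) (.seq (.sub _ _ _ _) (.seq (.add _ _ _ _)
      (.ifZero_true ?_ (.const _ _ _)))), by norm_num, rfl, fun r h1 h2 => ?_, .inl ⟨h, ?_⟩⟩ <;>
    simp [State.setReg, *]
  · refine ⟨_, _, .seq (.sub _ _ _ _) (.seq (.sub _ _ _ _) (.seq (.add _ _ _ _)
      (.ifZero_false ?_ (.const _ _ _)))), by norm_num, rfl, fun r h1 h2 => ?_, .inr ⟨h, ?_⟩⟩ <;>
    simp [State.setReg, *]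
    omega

/-- Equality of two numbers that straight-line code brings to registers `2` and `3`. -/
theorem eq_of_run {f g : (ℕ → ℕ) → (ℕ → ℕ) → ℕ}
    (hcongr : ∀ e e' mem, (∀ i < n, e i = e' i) → f e mem = f e' mem ∧ g e mem = g e' mem)
    (P : Prog) (T : ℕ) (hP : ∀ s, ∃ s', Run P s s' T ∧ s'.mem = s.mem ∧
      (∀ r, r ≠ 1 → r ≠ 2 → r ≠ 3 → s'.reg r = s.reg r) ∧ s'.reg 2 = f s.env s.mem ∧
      s'.reg 3 = g s.env s.mem) :
    PolyDecidable w n fun e mem _ => f e mem = g e mem := by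
  refine ⟨fun e e' mem N h => ?_, .seq P eqTest, Polynomial.C (T + 5), fun s N _ => ?_⟩
  · beta_reduce
    rw [(hcongr e e' mem h).1, (hcongr e e' mem h).2]
  · obtain ⟨s₁, hr₁, hm₁, hreg₁, h2, h3⟩ := hP s
    obtain ⟨s₂, t, hr₂, ht, hm₂, hreg₂, hres⟩ := run_eqTest s₁
    refine ⟨s₂, T + t, .seq hr₁ hr₂, by simpa using ht, hm₂.trans hm₁, ?_, fun i _ => ?_, ?_⟩
    · rw [hreg₂ 0 (by simp) (by simp), hreg₁ 0 (by simp) (by simp) (by simp)]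
    · simp only [State.env]
      rw [hreg₂ _ (by omega) (by omega), hreg₁ _ (by omega) (by omega) (by omega)]
    · rwa [h2, h3] at hres

theorem mem_eq_const {i : ℕ} (hi : i < n) (c : ℕ) :
    PolyDecidable w n fun e mem _ => mem (e i) = c :=
  eq_of_run (f := fun e mem => mem (e i)) (g := fun _ _ => c)
    (fun e e' mem h => ⟨congrArg mem (h i hi), rfl⟩) (.seq (.load 2 (4 + i)) (.const 3 c)) _
    fun s => ⟨_, .seq (.load _ _ _) (.const _ _ _), rfl,
      fun r _ h2 h3 => by simp [State.setReg, h2, h3], by simp [State.setReg, State.env],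
      by simp [State.setReg]⟩

theorem var_eq_var {i j : ℕ} (hi : i < n) (hj : j < n) :
    PolyDecidable w n fun e _ _ => e i = e j :=
  eq_of_run (f := fun e _ => e i) (g := fun e _ => e j)
    (fun e e' mem h => ⟨h i hi, h j hj⟩)
    (.seq (.const 3 0) (.seq (.add 2 (4 + i) 3) (.add 3 (4 + j) 3))) _
    fun s => ⟨_, .seq (.const _ _ _) (.seq (.add _ _ _ _) (.add _ _ _ _)), rfl,
      fun r _ h2 h3 => by simp [State.setReg, h2, h3],
      by simp [State.setReg, State.env, four_add_ne],
      by simp [State.setReg, State.env, four_add_ne]⟩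

theorem mem_eq_mem {i j : ℕ} (hi : i < n) (hj : j < n) (a : ℕ) :
    PolyDecidable w n fun e mem _ => mem (e i + 1 + a) = mem (e j + 1 + a) :=
  eq_of_run (f := fun e mem => mem (e i + 1 + a)) (g := fun e mem => mem (e j + 1 + a))
    (fun e e' mem h => by rw [h i hi, h j hj]; exact ⟨rfl, rfl⟩)
    (.seq (.const 3 (1 + a)) (.seq (.add 2 (4 + i) 3) (.seq (.add 3 (4 + j) 3)
      (.seq (.load 2 2) (.load 3 3))))) _
    fun s => ⟨_, .seq (.const _ _ _) (.seq (.add _ _ _ _) (.seq (.add _ _ _ _)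
      (.seq (.load _ _ _) (.load _ _ _)))), rfl,
      fun r _ h2 h3 => by simp [State.setReg, h2, h3],
      by simp [State.setReg, State.env, add_assoc, four_add_ne],
      by simp [State.setReg, State.env, add_assoc, four_add_ne]⟩

protected theorem not (h : PolyDecidable w n φ) : PolyDecidable w n fun e mem N => ¬ φ e mem N := by
  obtain ⟨hc, P, p, hP⟩ := h
  refine ⟨fun e e' mem N h => not_congr (hc e e' mem N h),
    .seq P (.ifZero 1 (.const 1 1) (.const 1 0)), p + 2, fun s N hN => ?_⟩
  obtain ⟨s₁, t, hr, ht, hm, h0, he, hres⟩ := hP s N hN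
  rcases hres with ⟨hφ, h1⟩ | ⟨hφ, h1⟩
  · exact ⟨_, _, .seq hr (.ifZero_false (by simp [h1]) (.const _ _ _)), by simpa using ht, hm,
      by simpa [State.setReg] using h0, fun i hi => by
        simpa [State.env, State.setReg, four_add_ne] using he i hi,
      .inr ⟨not_not.2 hφ, by simp [State.setReg]⟩⟩
  · exact ⟨_, _, .seq hr (.ifZero_true h1 (.const _ _ _)), by simpa using ht, hm,
      by simpa [State.setReg] using h0, fun i hi => by
        simpa [State.env, State.setReg, four_add_ne] using he i hi,
      .inl ⟨hφ, by simp [State.setReg]⟩⟩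

protected theorem true : PolyDecidable w n fun _ _ _ => True :=
  ⟨fun _ _ _ _ _ => Iff.rfl, .const 1 1, 1, fun s N _ =>
    ⟨_, _, .const _ _ _, by simp, rfl, by simp [State.setReg], fun i _ => by
      simp [State.env, State.setReg, four_add_ne], .inl ⟨trivial, by simp [State.setReg]⟩⟩⟩

protected theorem and (hn : 0 < n) (h : PolyDecidable w n φ) (h' : PolyDecidable w n ψ) :
    PolyDecidable w n fun e mem N => φ e mem N ∧ ψ e mem N := by
  obtain ⟨hc, P, p, hP⟩ := h
  obtain ⟨hc', P', p', hP'⟩ := h'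
  refine ⟨fun e e' mem N h => and_congr (hc e e' mem N h) (hc' e e' mem N h),
    .seq P (.ifZero 1 .skip P'), p + p' + 2, fun s N hN => ?_⟩
  obtain ⟨s₁, t, hr, ht, hm, h0, he, hres⟩ := hP s N hN
  rcases hres with ⟨hφ, h1⟩ | ⟨hφ, h1⟩
  · obtain ⟨s₂, t₂, hr₂, ht₂, hm₂, h0₂, he₂, hres₂⟩ := hP' s₁ N ((he 0 hn).trans hN)
    refine ⟨s₂, _, .seq hr (.ifZero_false (by simp [h1]) hr₂), ?_, hm₂.trans hm, h0₂.trans h0,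
      fun i hi => (he₂ i hi).trans (he i hi), ?_⟩
    · simp
      omega
    · rw [hc' s₁.env s.env _ _ he, hm] at hres₂
      simpa [hφ] using hres₂
  · refine ⟨s₁, _, .seq hr (.ifZero_true h1 (.skip _)), ?_, hm, h0, he, .inr ⟨fun h => hφ h.1, h1⟩⟩
    simp
    omega

protected theorem imp (hn : 0 < n) (h : PolyDecidable w n φ) (h' : PolyDecidable w n ψ) :
    PolyDecidable w n fun e mem N => φ e mem N → ψ e mem N :=
  (h.and hn h'.not).not.of_iff fun _ _ _ => by simp

/-- A condition that does not depend on the state is decided in advance. -/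
theorem static_imp (q : Prop) (h : q → PolyDecidable w n φ) :
    PolyDecidable w n fun e mem N => q → φ e mem N := by
  by_cases hq : q
  · exact (h hq).of_iff fun _ _ _ => by simp [hq]
  · exact PolyDecidable.true.of_iff fun _ _ _ => by simp [hq]

/-- The index type is fixed with the query, so the conjunction is unrolled into straight code rather
than a loop. -/
theorem forall_fintype (hn : 0 < n) {ι : Type*} [Fintype ι] {φ : ι → Pred}
    (h : ∀ i, PolyDecidable w n (φ i)) : PolyDecidable w n fun e mem N => ∀ i, φ i e mem N := by
  classical
  have key : ∀ S : Finset ι, PolyDecidable w n fun e mem N => ∀ i ∈ S, φ i e mem N := by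
    intro S
    induction S using Finset.induction_on with
    | empty => exact PolyDecidable.true.of_iff fun _ _ _ => by simp
    | insert a S _ ih => exact ((h a).and hn ih).of_iff fun _ _ _ => by simp
  exact (key Finset.univ).of_iff fun _ _ _ => by simp

/-- Quantification over all records. -/
theorem forall_record (hw : 0 < w) (hn : 0 < n) (h : PolyDecidable w (n + 1) φ) :
    PolyDecidable w n fun e mem N => ∀ j < N, φ (Function.update e n (j * w)) mem N := by
  obtain ⟨hc, P, p, hP⟩ := h
  refine ⟨fun e e' mem N h => forall_congr' fun j => imp_congr_right fun _ =>
      hc _ _ mem N fun i hi => ?_,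
    .seq (.const 1 1) (.seq (.const 2 0) (.seq (.add (4 + n) 4 2) (.loop (4 + n)
      (.seq (.const 2 w) (.seq (.sub (4 + n) (4 + n) 2)
        (.seq P (.ifZero 1 (.const (4 + n) 0) .skip))))))),
    Polynomial.X * (p + 5) + 4, fun s N hN => ?_⟩
  · rcases (Nat.lt_succ_iff_lt_or_eq.1 hi) with hi | rfl
    · rw [Function.update_of_ne hi.ne, Function.update_of_ne hi.ne, h i hi]
    · simp
  -- Addresses descend from the end address, and `k` counts the records still to be tested. A
  -- counterexample sets the counter to `0` at once, which is why the loop rule lets the measure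
  -- drop by more than one.
  set Inv : ℕ → State → Prop := fun k s' => s'.mem = s.mem ∧ s'.reg 0 = s.reg 0 ∧
    (∀ i < n, s'.env i = s.env i) ∧ s'.env n = k * w ∧ k ≤ N ∧
    ((s'.reg 1 = 1 ∧ ∀ j, k ≤ j → j < N → φ (Function.update s.env n (j * w)) s.mem N) ∨
      (s'.reg 1 = 0 ∧ k = 0 ∧ ∃ j < N, ¬ φ (Function.update s.env n (j * w)) s.mem N)) with hInv
  have hstep : ∀ k s', Inv (k + 1) s' → s'.reg (4 + n) ≠ 0 ∧ ∃ s'' t k',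
      Run (.seq (.const 2 w) (.seq (.sub (4 + n) (4 + n) 2)
        (.seq P (.ifZero 1 (.const (4 + n) 0) .skip)))) s' s'' t ∧ t ≤ p.eval N + 4 ∧
      k' ≤ k ∧ Inv k' s'' := by
    rintro k s' ⟨hm, h0, he, hen, hkN, hres⟩
    have hres1 : ∀ j, k + 1 ≤ j → j < N → φ (Function.update s.env n (j * w)) s.mem N := by
      rcases hres with h | h
      · exact h.2
      · omega
    have hen' : s'.reg (4 + n) = (k + 1) * w := hen
    refine ⟨by rw [hen']; positivity, ?_⟩
    set s₁ := (s'.setReg 2 w).setReg (4 + n)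
      ((s'.setReg 2 w).reg (4 + n) - (s'.setReg 2 w).reg 2) with hs₁
    have he₁ : ∀ i < n + 1, s₁.env i = Function.update s.env n (k * w) i := by
      intro i hi
      rcases (Nat.lt_succ_iff_lt_or_eq.1 hi) with hi | rfl
      · rw [Function.update_of_ne hi.ne, ← he i hi]
        simp [hs₁, State.env, State.setReg, hi.ne, four_add_ne]
      · simp [hs₁, State.env, State.setReg, four_add_ne, hen', Nat.add_mul]
    have h0₁ : s₁.env 0 = N * w := by
      rw [he₁ 0 (by omega), Function.update_of_ne hn.ne, hN]
    obtain ⟨s₂, t, hr, ht, hm₂, h0₂, he₂, hres₂⟩ := hP s₁ N h0₁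
    have hm₁ : s₁.mem = s.mem := hm
    have h01 : s₁.reg 0 = s.reg 0 := by
      rw [← h0]
      simp [hs₁, State.setReg, four_add_ne]
    rw [hc _ _ _ _ he₁, hm₁] at hres₂
    have hes : ∀ i < n, s₂.env i = s.env i := fun i hi => by
      rw [he₂ i (by omega), he₁ i (by omega), Function.update_of_ne hi.ne]
    rcases hres₂ with ⟨hφ, h1⟩ | ⟨hφ, h1⟩
    · refine ⟨s₂, _, k, .seq (.const _ _ _) (.seq (.sub _ _ _ _)
        (.seq hr (.ifZero_false (by simp [h1]) (.skip _)))), by omega, le_rfl,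
        hm₂.trans hm₁, h0₂.trans h01, hes, ?_, by omega, .inl ⟨h1, fun j hkj hj => ?_⟩⟩
      · rw [he₂ n (by omega), he₁ n (by omega), Function.update_self]
      · rcases hkj.eq_or_lt with rfl | hkj
        · exact hφ
        · exact hres1 j hkj hj
    · refine ⟨s₂.setReg (4 + n) 0, _, 0, .seq (.const _ _ _) (.seq (.sub _ _ _ _)
        (.seq hr (.ifZero_true h1 (.const _ _ _)))), by omega, Nat.zero_le _,
        hm₂.trans hm₁, ?_, fun i hi => ?_, ?_, Nat.zero_le _, .inr ⟨?_, rfl, k, by omega, hφ⟩⟩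
      · rw [← h01, ← h0₂]
        simp [State.setReg, four_add_ne]
      · rw [← hes i hi]
        simp [State.env, State.setReg, hi.ne]
      · simp [State.env, State.setReg]
      · rw [← h1]
        simp [State.setReg, four_add_ne]
  set s₀ := ((s.setReg 1 1).setReg 2 0).setReg (4 + n)
      (((s.setReg 1 1).setReg 2 0).reg 4 + ((s.setReg 1 1).setReg 2 0).reg 2) with hs₀
  have hinit : Inv N s₀ := by
    refine ⟨rfl, ?_, fun i hi => ?_, ?_, le_rfl, .inl ⟨?_, fun j h1 h2 => by omega⟩⟩
    · simp [hs₀, State.setReg, four_add_ne]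
    · simp [hs₀, State.env, State.setReg, hi.ne, four_add_ne]
    · rw [← hN]
      simp [hs₀, State.env, State.setReg]
    · simp [hs₀, State.setReg, four_add_ne]
  obtain ⟨s', t, hr, ht, hm, h0, he, -, -, hres⟩ := Run.exists_loop Inv
    (fun s' h => by simpa [State.env] using h.2.2.2.1) hstep N s₀ hinit
  refine ⟨s', _, .seq (.const _ _ _) (.seq (.const _ _ _) (.seq (.add _ _ _ _) hr)), ?_, hm, h0,
    he, ?_⟩
  · simp only [Polynomial.eval_add, Polynomial.eval_mul, Polynomial.eval_X, Polynomial.eval_ofNat]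
    have ht' : t ≤ N * (p.eval N + 5) + 1 := ht
    omega
  · rcases hres with ⟨h1, h⟩ | ⟨h1, -, j, hj, h⟩
    · exact .inl ⟨fun j hj => h j (Nat.zero_le _) hj, h1⟩
    · exact .inr ⟨fun h' => h (h' j hj), h1⟩

/-- Quantification over `m`-tuples of records. -/
theorem forall_records (hw : 0 < w) (hn : 0 < n) (m : ℕ) :
    ∀ {φ : Pred}, PolyDecidable w (n + m) φ → PolyDecidable w n fun e mem N =>
      ∀ e' : ℕ → ℕ, (∀ i < n, e' i = e i) → (∀ i < m, ∃ j < N, e' (n + i) = j * w) →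
        φ e' mem N := by
  induction m with
  | zero =>
    intro φ h
    refine h.of_iff fun e mem N => ⟨fun h' => h' e (fun _ _ => rfl) (by simp), fun h' e' he _ => ?_⟩
    exact (h.1 e' e mem N he).2 h'
  | succ m ih =>
    intro φ h
    refine (ih (forall_record hw (by omega) h)).of_iff fun e mem N => ⟨?_, ?_⟩
    · intro h' e' he hj j hjN
      refine h' _ (fun i hi => ?_) fun i hi => ?_
      · rw [Function.update_of_ne (by omega), he i hi]
      · rcases (Nat.lt_succ_iff_lt_or_eq.1 hi) with hi | rfl
        · rw [Function.update_of_ne (by omega)]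
          exact hj i hi
        · exact ⟨j, hjN, by simp⟩
    · intro h' e' he hj
      obtain ⟨j, hjN, hjm⟩ := hj m (by omega)
      have := h' e' he (fun i hi => hj i (by omega)) j hjN
      rwa [← hjm, Function.update_eq_self] at this

end PolyDecidable

end Machine

/-! ### Databases in memory -/

section Memory

variable {Q : CQ}

/-- The memory holds the facts `r 0, …, r (N - 1)`. -/
def Encodes (Q : CQ) (mem : ℕ → ℕ) (N : ℕ) (r : ℕ → Fact Q) : Prop :=
  ∀ j < N, mem (j * (1 + Q.numAttr)) = ((r j).1 : ℕ) ∧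
    ∀ A : {A : Fin Q.numAttr // A ∈ Q.attr (r j).1},
      mem (j * (1 + Q.numAttr) + 1 + (A.1 : ℕ)) = (r j).2 A

/-- Only words at attributes of the relation are compared, as the others in a record are arbitrary.
-/
theorem Encodes.eq_iff {mem : ℕ → ℕ} {N : ℕ} {r : ℕ → Fact Q} (h : Encodes Q mem N r) {j : ℕ}
    (hj : j < N) (i : Fin Q.numRel) (t : Fin Q.numAttr → ℕ) :
    r j = ⟨i, proj (Q.attr i) t⟩ ↔ mem (j * (1 + Q.numAttr)) = i ∧
      ∀ A ∈ Q.attr i, mem (j * (1 + Q.numAttr) + 1 + (A : ℕ)) = t A := by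
  have hj := h j hj
  generalize r j = f at hj ⊢
  obtain ⟨i', u⟩ := f
  constructor
  · rintro h
    obtain ⟨rfl, h⟩ := Sigma.mk.inj h
    rw [eq_of_heq h] at hj
    exact ⟨hj.1, fun A hA => hj.2 ⟨A, hA⟩⟩
  · rintro ⟨h1, h2⟩
    obtain rfl : i' = i := Fin.ext (hj.1.symm.trans h1)
    congr 1
    funext A
    exact (hj.2 A).symm.trans (h2 A.1 A.2)

theorem Holds.exists_encodes (hQ : 0 < Q.numAttr) {s : State} {D : Database Q} (h : Holds Q s D) :
    ∃ r : ℕ → Fact Q, Encodes Q s.mem D.card r ∧ s.reg 0 = D.card ∧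
      Set.InjOn r (Set.Iio D.card) ∧ (Finset.range D.card).image r = D := by
  obtain ⟨l, hl, rfl, h0, hmem⟩ := h
  rw [List.toFinset_card_of_nodup hl]
  -- The default fact, never read below the length, uses relation `0`, which exists because there is
  -- an attribute.
  have hr : ∀ j (hj : j < l.length),
      l.getD j ⟨⟨0, CQ.numRel_pos hQ⟩, fun _ => 0⟩ = l[j] := fun j hj => by simp [hj]
  refine ⟨fun j => l.getD j ⟨⟨0, CQ.numRel_pos hQ⟩, fun _ => 0⟩, fun j hj => ?_, h0, ?_, ?_⟩
  · beta_reduce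
    rw [hr j hj]
    exact hmem j hj
  · intro j hj j' hj' hjj
    simp only [Set.mem_Iio] at hj hj'
    beta_reduce at hjj
    rw [hr j hj, hr j' hj'] at hjj
    exact (hl.getElem_inj_iff).1 hjj
  · ext f
    simp only [Finset.mem_image, Finset.mem_range, List.mem_toFinset, List.mem_iff_getElem]
    constructor
    · rintro ⟨j, hj, rfl⟩
      exact ⟨j, hj, (hr j hj).symm⟩
    · rintro ⟨j, hj, rfl⟩
      exact ⟨j, hj, hr j hj⟩

theorem Encodes.holds {s : State} {N : ℕ} {r : ℕ → Fact Q} (h : Encodes Q s.mem N r)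
    (h0 : s.reg 0 = N) (hr : Set.InjOn r (Set.Iio N)) :
    Holds Q s ((Finset.range N).image r) := by
  refine ⟨(List.range N).map r, List.Nodup.map_on (fun a ha b hb hab => hr ?_ ?_ hab)
    List.nodup_range, ?_, by simpa using h0, fun j hj => ?_⟩
  · simpa using ha
  · simpa using hb
  · ext f
    simp
  · have hj' : j < N := by simpa using hj
    have : ((List.range N).map r)[j] = r j := by simp
    rw [this]
    exact h j hj'

/-! ### Deciding redundancy of a fact -/

/-- Some relation that contains the attribute `A`. -/
noncomputable def CQ.relOf (Q : CQ) (A : Fin Q.numAttr) : Fin Q.numRel := (Q.covered A).choose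

theorem CQ.mem_attr_relOf (A : Fin Q.numAttr) : A ∈ Q.attr (Q.relOf A) := (Q.covered A).choose_spec

/-- The records addressed by the variables `o, …, o + m - 1` match; that is, they hold facts of
the `m` relations that agree on common attributes. -/
def CQ.Match (Q : CQ) (o : ℕ) (e mem : ℕ → ℕ) : Prop :=
  ∀ i : Fin Q.numRel, mem (e (o + i)) = i ∧
    ∀ A : Fin Q.numAttr, A ∈ Q.attr i →
      mem (e (o + i) + 1 + A) = mem (e (o + Q.relOf A) + 1 + A)

theorem polyDecidable_match {w n o : ℕ} (hn : 0 < n) (ho : o + Q.numRel ≤ n) :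
    PolyDecidable w n fun e mem _ => Q.Match o e mem :=
  .forall_fintype hn fun i => .and hn (.mem_eq_const (by omega) _) <|
    .forall_fintype hn fun A => .static_imp _ fun _ =>
      .mem_eq_mem (by omega) (by have := (Q.relOf A).2; omega) _

/-- Variable `1` addresses a record that is redundant for the query. -/
def CQ.Redundant (Q : CQ) : Pred := fun e mem N =>
  ∀ e' : ℕ → ℕ, (∀ i < 2, e' i = e i) →
    (∀ i < Q.numRel, ∃ j < N, e' (2 + i) = j * (1 + Q.numAttr)) → Q.Match 2 e' mem →
    ¬ ∀ e'' : ℕ → ℕ, (∀ i < 2 + Q.numRel, e'' i = e' i) →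
      (∀ i < Q.numRel, ∃ j < N, e'' (2 + Q.numRel + i) = j * (1 + Q.numAttr)) →
      ¬ (Q.Match (2 + Q.numRel) e'' mem ∧
        (∀ i : Fin Q.numRel, ¬ e'' (2 + Q.numRel + i) = e'' 1) ∧
        ∀ A : Fin Q.numAttr, A ∈ Q.head →
          mem (e'' (2 + Q.relOf A) + 1 + A) = mem (e'' (2 + Q.numRel + Q.relOf A) + 1 + A))

/-- Variable `0` is the end address, variable `1` the candidate, followed by two blocks of `m`
record addresses. The existential over the second block is written as a negated universal, the only
record quantifier available. -/
theorem polyDecidable_redundant : PolyDecidable (1 + Q.numAttr) 2 Q.Redundant := by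
  have hw : 0 < 1 + Q.numAttr := by omega
  refine .forall_records hw (by omega) _ (.imp (by omega) (polyDecidable_match (by omega) le_rfl)
    (.not (.forall_records hw (by omega) _ (.not (.and (by omega)
      (polyDecidable_match (by omega) le_rfl) (.and (by omega)
        (.forall_fintype (by omega) fun i => .not (.var_eq_var (by omega) (by omega)))
        (.forall_fintype (by omega) fun A => .static_imp _ fun _ => ?_)))))))
  have := (Q.relOf A).2
  exact .mem_eq_mem (by omega) (by omega) _

/-- The values given to the variables by the records `J 0, …, J (m - 1)`. -/
def extendEnv (w n m : ℕ) (e : ℕ → ℕ) (J : Fin m → ℕ) : ℕ → ℕ := fun x =>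
  if x < n then e x else if h : x - n < m then J ⟨x - n, h⟩ * w else 0

theorem extendEnv_of_lt {w n m : ℕ} {e : ℕ → ℕ} {J : Fin m → ℕ} {x : ℕ} (hx : x < n) :
    extendEnv w n m e J x = e x := if_pos hx

theorem extendEnv_add {w n m : ℕ} {e : ℕ → ℕ} {J : Fin m → ℕ} (i : Fin m) :
    extendEnv w n m e J (n + i) = J i * w := by
  simp [extendEnv]

/-- The tuple of the values found in matching records. -/
noncomputable def CQ.tupleOf (Q : CQ) (o : ℕ) (e mem : ℕ → ℕ) : Fin Q.numAttr → ℕ :=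
  fun A => mem (e (o + Q.relOf A) + 1 + A)

theorem Encodes.match_iff {mem : ℕ → ℕ} {N : ℕ} {r : ℕ → Fact Q} (h : Encodes Q mem N r) {o : ℕ}
    {e : ℕ → ℕ} {J : Fin Q.numRel → ℕ} (hJ : ∀ i, J i < N)
    (he : ∀ i : Fin Q.numRel, e (o + i) = J i * (1 + Q.numAttr)) :
    Q.Match o e mem ↔ ∀ i, r (J i) = ⟨i, proj (Q.attr i) (Q.tupleOf o e mem)⟩ := by
  refine forall_congr' fun i => ?_
  rw [h.eq_iff (hJ i), he i]
  rfl

theorem Encodes.tupleOf_eq {mem : ℕ → ℕ} {N : ℕ} {r : ℕ → Fact Q} (h : Encodes Q mem N r) {o : ℕ}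
    {e : ℕ → ℕ} {J : Fin Q.numRel → ℕ} (hJ : ∀ i, J i < N)
    (he : ∀ i : Fin Q.numRel, e (o + i) = J i * (1 + Q.numAttr)) {t : Fin Q.numAttr → ℕ}
    (ht : ∀ i, r (J i) = ⟨i, proj (Q.attr i) t⟩) : Q.tupleOf o e mem = t := by
  funext A
  rw [CQ.tupleOf, he]
  exact ((h.eq_iff (hJ _) _ _).1 (ht (Q.relOf A))).2 A (CQ.mem_attr_relOf A)

/-- The first block ranges over the joining facts of each result, the second over joining facts with
the same head that avoid the candidate. Avoiding its address is avoiding the fact, since records do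
not repeat. -/
theorem Encodes.redundant_iff {mem : ℕ → ℕ} {N : ℕ} {r : ℕ → Fact Q} (h : Encodes Q mem N r)
    (hr : Set.InjOn r (Set.Iio N)) {e : ℕ → ℕ} {c : ℕ} (hc : c < N)
    (he : e 1 = c * (1 + Q.numAttr)) :
    Q.Redundant e mem N ↔ Q.result (((Finset.range N).image r).erase (r c)) =
      Q.result ((Finset.range N).image r) := by
  have hw : 1 + Q.numAttr ≠ 0 := by omega
  constructor
  · refine fun hred => (CQ.result_mono (Finset.erase_subset _ _)).antisymm ?_
    rintro _ ⟨t, ht, rfl⟩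
    simp only [Finset.mem_image, Finset.mem_range] at ht
    choose J hJ hJt using ht
    have he' := extendEnv_add (w := 1 + Q.numAttr) (n := 2) (e := e) (J := J)
    set e' := extendEnv (1 + Q.numAttr) 2 Q.numRel e J with he'_def
    have ht' := h.tupleOf_eq hJ he' hJt
    have hmatch : Q.Match 2 e' mem := (h.match_iff hJ he').2 (by rwa [ht'])
    have hex := hred e' (fun i hi => extendEnv_of_lt hi)
      (fun i hi => ⟨J ⟨i, hi⟩, hJ _, he' ⟨i, hi⟩⟩) hmatch
    push Not at hex
    obtain ⟨e'', hlt, hrec, hm, hne, hhead⟩ := hex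
    have hrec' : ∀ i : Fin Q.numRel, ∃ j < N, e'' (2 + Q.numRel + i) = j * (1 + Q.numAttr) :=
      fun i => hrec i i.2
    choose K hK hKe using hrec'
    rw [h.match_iff hK hKe] at hm
    refine ⟨Q.tupleOf (2 + Q.numRel) e'' mem, fun i => ?_, funext fun A => ?_⟩
    · rw [← hm i, Finset.mem_erase]
      refine ⟨fun heq => hne i ?_, Finset.mem_image_of_mem _ (Finset.mem_range.2 (hK i))⟩
      rw [hKe, hr (hK i) hc heq, hlt 1 (by omega), he'_def, extendEnv_of_lt (by omega), he]
    · have := hhead A.1 A.2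
      rw [hlt _ (by have := (Q.relOf A.1).2; omega)] at this
      rw [← ht']
      exact this
  · intro heq e' he2 hrec hm hno
    have hrec' : ∀ i : Fin Q.numRel, ∃ j < N, e' (2 + i) = j * (1 + Q.numAttr) :=
      fun i => hrec i i.2
    choose J hJ hJe using hrec'
    rw [h.match_iff hJ hJe] at hm
    have hmem : proj Q.head (Q.tupleOf 2 e' mem) ∈ Q.result ((Finset.range N).image r) :=
      ⟨_, fun i => Finset.mem_image.2 ⟨J i, Finset.mem_range.2 (hJ i), hm i⟩, rfl⟩
    rw [← heq] at hmem
    obtain ⟨t, ht, htu⟩ := hmem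
    simp only [Finset.mem_erase, Finset.mem_image, Finset.mem_range] at ht
    choose hne K hK hKt using ht
    have he'' := extendEnv_add (w := 1 + Q.numAttr) (n := 2 + Q.numRel) (e := e') (J := K)
    have hlt : ∀ x < 2 + Q.numRel,
      extendEnv (1 + Q.numAttr) (2 + Q.numRel) Q.numRel e' K x = e' x := fun x => extendEnv_of_lt
    set e'' := extendEnv (1 + Q.numAttr) (2 + Q.numRel) Q.numRel e' K
    have ht' := h.tupleOf_eq hK he'' hKt
    refine hno e'' hlt (fun i hi => ⟨K ⟨i, hi⟩, hK _, he'' ⟨i, hi⟩⟩)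
      ⟨(h.match_iff hK he'').2 (by rwa [ht']), fun i heq' => ?_, fun A hA => ?_⟩
    · rw [he'', hlt 1 (by omega), he2 1 (by omega), he] at heq'
      apply hne i
      rw [← hKt i, Nat.eq_of_mul_eq_mul_right (by omega) heq']
    · rw [hlt _ (by have := (Q.relOf A).2; omega)]
      have := congrFun htu ⟨A, hA⟩
      rw [← ht'] at this
      exact this

end Memory

/-! ### Greedy deletion of redundant facts -/

/-- Copy `b` words from the address in register `4` to the address in register `5`. -/
def copyProg : ℕ → Prog
  | 0 => .skip
  | b + 1 => .seq (copyProg b) (.seq (.const 2 b) (.seq (.add 3 4 2) (.seq (.load 3 3)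
      (.seq (.add 2 5 2) (.store 2 3)))))

/-- The target block is the source itself (the last record is being deleted) or lies entirely below
it, so no word is overwritten before it is read. -/
theorem run_copyProg (b : ℕ) (s : State)
    (hsep : s.reg 5 = s.reg 4 ∨ s.reg 5 + b ≤ s.reg 4) :
    ∃ s' t, Run (copyProg b) s s' t ∧ t ≤ 5 * b + 1 ∧
      (∀ r, r ≠ 2 → r ≠ 3 → s'.reg r = s.reg r) ∧
      (∀ a < b, s'.mem (s.reg 5 + a) = s.mem (s.reg 4 + a)) ∧
      ∀ x, (x < s.reg 5 ∨ s.reg 5 + b ≤ x) → s'.mem x = s.mem x := by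
  induction b with
  | zero => exact ⟨s, 1, .skip s, le_rfl, fun _ _ _ => rfl, by simp, fun _ _ => rfl⟩
  | succ b ih =>
    obtain ⟨s', t, hr, ht, hreg, hnew, hold⟩ := ih (by omega)
    have h4 := hreg 4 (by simp) (by simp)
    have h5 := hreg 5 (by simp) (by simp)
    refine ⟨_, _, .seq hr (.seq (.const 2 b _) (.seq (.add 3 4 2 _)
      (.seq (.load 3 3 _) (.seq (.add 2 5 2 _) (.store 2 3 _))))), by omega, fun r h2 h3 => ?_,
      fun a ha => ?_, fun x hx => ?_⟩
    · simp [State.setReg, State.setMem, h2, h3, hreg]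
    · simp only [State.setReg, State.setMem, Function.update_apply]
      norm_num
      rw [h4, h5]
      split_ifs with hab
      · obtain rfl : a = b := by omega
        exact hold _ (by omega)
      · exact hnew a (by omega)
    · simp only [State.setReg, State.setMem, Function.update_apply]
      norm_num
      rw [h4, h5, if_neg (by omega)]
      exact hold x (by omega)

/-- Set register `4` to `b` times register `0`. -/
def mulProg : ℕ → Prog
  | 0 => .const 4 0
  | b + 1 => .seq (mulProg b) (.add 4 4 0)

theorem run_mulProg (b : ℕ) (s : State) :
    ∃ s', Run (mulProg b) s s' (b + 1) ∧ s'.mem = s.mem ∧ s'.reg 0 = s.reg 0 ∧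
      s'.reg 4 = s.reg 0 * b := by
  induction b with
  | zero => exact ⟨_, .const 4 0 s, rfl, by simp [State.setReg], by simp [State.setReg]⟩
  | succ b ih =>
    obtain ⟨s', hr, hm, h0, h4⟩ := ih
    exact ⟨_, .seq hr (.add _ _ _ _), hm, by simpa [State.setReg] using h0,
      by simp [State.setReg, h0, h4, Nat.mul_add]⟩

variable {Q : CQ}

/-- Deletion moves the last record into slot `c` and shortens the list; for `c = N` the update falls
outside the range and has no effect. -/
theorem image_update_range {N c : ℕ} {r : ℕ → Fact Q} (hr : Set.InjOn r (Set.Iio (N + 1)))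
    (hc : c < N + 1) : (Finset.range N).image (Function.update r c (r N)) =
      ((Finset.range (N + 1)).image r).erase (r c) := by
  ext f
  simp only [Finset.mem_image, Finset.mem_range, Finset.mem_erase]
  constructor
  · rintro ⟨j, hj, rfl⟩
    rcases eq_or_ne j c with rfl | hjc
    · rw [Function.update_self]
      exact ⟨fun h => hj.ne' (hr (Set.mem_Iio.2 (by omega)) hc h), N, by omega, rfl⟩
    · rw [Function.update_of_ne hjc]
      exact ⟨fun h => hjc (hr (Set.mem_Iio.2 (by omega)) hc h), j, by omega, rfl⟩
  · rintro ⟨hne, j, hj, rfl⟩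
    have hjc : j ≠ c := fun h => hne (by rw [h])
    rcases (Nat.lt_succ_iff_lt_or_eq.1 hj) with hj | rfl
    · exact ⟨j, hj, by rw [Function.update_of_ne hjc]⟩
    · exact ⟨c, by omega, by rw [Function.update_self]⟩

theorem injOn_update {N c : ℕ} {r : ℕ → Fact Q} (hr : Set.InjOn r (Set.Iio (N + 1))) :
    Set.InjOn (Function.update r c (r N)) (Set.Iio N) := by
  intro i hi j hj hij
  simp only [Set.mem_Iio] at hi hj
  have key : ∀ a b, a < N + 1 → b < N + 1 → r a = r b → a = b := fun a b ha hb h =>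
    hr (Set.mem_Iio.2 ha) (Set.mem_Iio.2 hb) h
  simp only [Function.update_apply] at hij
  split_ifs at hij with h1 h2 h2
  · omega
  · have := key _ _ (by omega) (by omega) hij
    omega
  · have := key _ _ (by omega) (by omega) hij
    omega
  · exact key _ _ (by omega) (by omega) hij

/-- A fact without which some result is lost remains so when a redundant fact is removed. -/
theorem CQ.result_erase_ne {D : Database Q} {f g : Fact Q}
    (hf : Q.result (D.erase f) ≠ Q.result D) (hg : Q.result (D.erase g) = Q.result D) :
    Q.result ((D.erase g).erase f) ≠ Q.result (D.erase g) := fun h =>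
  hf ((CQ.result_mono (Finset.erase_subset _ _)).antisymm
    (hg ▸ h ▸ CQ.result_mono (Finset.erase_subset_erase _ (Finset.erase_subset _ _))))

/-- The invariant of the greedy algorithm: the facts from number `c` on are not redundant. -/
def GreedyInv (Q : CQ) (D : Database Q) (c : ℕ) (s : State) : Prop :=
  ∃ (N : ℕ) (r : ℕ → Fact Q), N ≤ D.card ∧ c ≤ N ∧ s.reg 0 = N ∧
    s.reg 4 = N * (1 + Q.numAttr) ∧ s.reg 5 = c * (1 + Q.numAttr) ∧
    Encodes Q s.mem N r ∧ Set.InjOn r (Set.Iio N) ∧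
    IsWitness Q D ((Finset.range N).image r) ∧
    ∀ j, c ≤ j → j < N → Q.result (((Finset.range N).image r).erase (r j)) ≠
      Q.result ((Finset.range N).image r)

/-- The loop body of the greedy algorithm, where `P` decides redundancy. -/
def greedyBody (w : ℕ) (P : Prog) : Prog :=
  .seq (.const 2 w) (.seq (.sub 5 5 2) (.seq P (.ifZero 1 .skip
    (.seq (.const 2 1) (.seq (.sub 0 0 2) (.seq (.const 2 w) (.seq (.sub 4 4 2)
      (copyProg w))))))))

theorem Encodes.update {mem mem' : ℕ → ℕ} {N c : ℕ} {r : ℕ → Fact Q}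
    (h : Encodes Q mem (N + 1) r)
    (hnew : ∀ a < 1 + Q.numAttr,
      mem' (c * (1 + Q.numAttr) + a) = mem (N * (1 + Q.numAttr) + a))
    (hold : ∀ x, (x < c * (1 + Q.numAttr) ∨ c * (1 + Q.numAttr) + (1 + Q.numAttr) ≤ x) →
      mem' x = mem x) :
    Encodes Q mem' N (Function.update r c (r N)) := by
  intro j hj
  rcases eq_or_ne j c with rfl | hjc
  · rw [Function.update_self]
    have hN := h N (by omega)
    refine ⟨by simpa [hN.1] using hnew 0 (by omega), fun A => ?_⟩
    rw [add_assoc, hnew _ (by have := A.1.2; omega), ← add_assoc]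
    exact hN.2 A
  · rw [Function.update_of_ne hjc]
    have hj := h j (by omega)
    have hout : ∀ a < 1 + Q.numAttr,
        mem' (j * (1 + Q.numAttr) + a) = mem (j * (1 + Q.numAttr) + a) := by
      intro a ha
      apply hold
      rcases lt_or_gt_of_ne hjc with hlt | hlt
      · have := Nat.mul_le_mul_right (1 + Q.numAttr) (Nat.succ_le_of_lt hlt)
        rw [Nat.succ_mul] at this
        omega
      · have := Nat.mul_le_mul_right (1 + Q.numAttr) (Nat.succ_le_of_lt hlt)
        rw [Nat.succ_mul] at this
        omega
    refine ⟨by simpa [hj.1] using hout 0 (by omega), fun A => ?_⟩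
    rw [add_assoc, hout _ (by have := A.1.2; omega), ← add_assoc]
    exact hj.2 A

/-- The candidate index moves down by one in either case. A record moved into the freed slot comes
from the end, hence was already found not redundant and needs no second test. -/
theorem greedy_step {P : Prog} {p : Polynomial ℕ}
    (hP : ∀ (s : State) (N : ℕ), s.env 0 = N * (1 + Q.numAttr) →
      ∃ s' t, Run P s s' t ∧ t ≤ p.eval N ∧ s'.mem = s.mem ∧ s'.reg 0 = s.reg 0 ∧
        (∀ i < 2, s'.env i = s.env i) ∧
        (Q.Redundant s.env s.mem N ∧ s'.reg 1 = 1 ∨ ¬ Q.Redundant s.env s.mem N ∧ s'.reg 1 = 0))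
    (D : Database Q) (c : ℕ) (s : State) (h : GreedyInv Q D (c + 1) s) :
    s.reg 5 ≠ 0 ∧ ∃ s' t c', Run (greedyBody (1 + Q.numAttr) P) s s' t ∧
      t ≤ p.eval D.card + (5 * (1 + Q.numAttr) + 8) ∧ c' ≤ c ∧ GreedyInv Q D c' s' := by
  obtain ⟨N, r, hND, hcN, h0, h4, h5, henc, hinj, hwit, hess⟩ := h
  obtain ⟨N, rfl⟩ : ∃ M, N = M + 1 := ⟨N - 1, by omega⟩
  set w := 1 + Q.numAttr with hw
  have hw0 : 0 < w := by omega
  refine ⟨by rw [h5]; positivity, ?_⟩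
  set s₁ := (s.setReg 2 w).setReg 5 ((s.setReg 2 w).reg 5 - (s.setReg 2 w).reg 2) with hs₁
  have h51 : s₁.env 1 = c * w := by simp [hs₁, State.env, State.setReg, h5, Nat.add_mul]
  have h41 : s₁.env 0 = (N + 1) * w := by simp [hs₁, State.env, State.setReg, h4]
  have h01 : s₁.reg 0 = N + 1 := by simp [hs₁, State.setReg, h0]
  obtain ⟨s₂, t, hr, ht, hm₂, h02, he₂, hres⟩ := hP s₁ (N + 1) h41
  have ht' := ht.trans (polynomial_eval_mono p hND)
  have hm : s₂.mem = s.mem := hm₂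
  have h52 : s₂.reg 5 = c * w := (he₂ 1 (by omega)).trans h51
  have h42 : s₂.reg 4 = (N + 1) * w := (he₂ 0 (by omega)).trans h41
  have henc₁ : Encodes Q s₁.mem (N + 1) r := henc
  rw [henc₁.redundant_iff hinj (by omega) h51] at hres
  rcases hres with ⟨hred, h1⟩ | ⟨hred, h1⟩
  · set s₃ := (((s₂.setReg 2 1).setReg 0
        ((s₂.setReg 2 1).reg 0 - (s₂.setReg 2 1).reg 2)).setReg 2 w) with hs₃
    set s₄ := s₃.setReg 4 (s₃.reg 4 - s₃.reg 2) with hs₄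
    have h04 : s₄.reg 0 = N := by simp [hs₄, hs₃, State.setReg, h02, h01]
    have h44 : s₄.reg 4 = N * w := by simp [hs₄, hs₃, State.setReg, h42, Nat.add_mul]
    have h54 : s₄.reg 5 = c * w := by simp [hs₄, hs₃, State.setReg, h52]
    have hm₄ : s₄.mem = s.mem := hm
    obtain ⟨s₅, t₅, hr₅, ht₅, hreg, hnew, hold⟩ := run_copyProg w s₄ (by
      rw [h44, h54]
      rcases (Nat.lt_succ_iff_lt_or_eq.1 hcN) with hlt | rfl
      · have := Nat.mul_le_mul_right w (Nat.succ_le_of_lt hlt)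
        rw [Nat.succ_mul] at this
        exact .inr this
      · exact .inl rfl)
    rw [h54, hm₄] at hnew hold
    rw [h44] at hnew
    refine ⟨s₅, _, c, .seq (.const _ _ _) (.seq (.sub _ _ _ _) (.seq hr
      (.ifZero_false (by simp [h1]) (.seq (.const _ _ _) (.seq (.sub _ _ _ _)
        (.seq (.const _ _ _) (.seq (.sub _ _ _ _) hr₅))))))), by omega, le_rfl, ?_⟩
    refine ⟨N, Function.update r c (r N), by omega, by omega,
      (hreg 0 (by simp) (by simp)).trans h04, (hreg 4 (by simp) (by simp)).trans h44,
      (hreg 5 (by simp) (by simp)).trans h54, henc.update hnew hold,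
      injOn_update hinj, ?_, fun j hcj hjN => ?_⟩
    · rw [image_update_range hinj (by omega)]
      exact ⟨(Finset.erase_subset _ _).trans hwit.1, hred.trans hwit.2⟩
    · rw [image_update_range hinj (by omega)]
      refine CQ.result_erase_ne ?_ hred
      rcases eq_or_ne j c with rfl | hjc
      -- Slot `c` now holds the former last record; `c < N` here, so it had been tested before.
      · rw [Function.update_self]
        exact hess N (by omega) (by omega)
      · rw [Function.update_of_ne hjc]
        exact hess j (by omega) (by omega)
  · refine ⟨s₂, _, c, .seq (.const _ _ _) (.seq (.sub _ _ _ _) (.seq hr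
      (.ifZero_true h1 (.skip _)))), by omega, le_rfl, N + 1, r, hND, by omega,
      h02.trans h01, h42, h52, hm ▸ henc, hinj, hwit, fun j hcj hjN => ?_⟩
    rcases hcj.eq_or_lt with rfl | hcj
    · exact hred
    · exact hess j hcj hjN

theorem solvableInPolyTime_isUnionOfSmallestWitnesses (hQ : 0 < Q.numAttr) :
    SolvableInPolyTime Q (IsUnionOfSmallestWitnesses Q) := by
  obtain ⟨-, P, p, hP⟩ := polyDecidable_redundant (Q := Q)
  refine ⟨.seq (mulProg (1 + Q.numAttr)) (.seq (.const 2 0) (.seq (.add 5 4 2)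
      (.loop 5 (greedyBody (1 + Q.numAttr) P)))),
    -- The constant term collects the `numAttr + 2` steps of `mulProg`, two instructions and the
    -- final loop test.
    Polynomial.X * (p + Polynomial.C (5 * (1 + Q.numAttr) + 9)) + Polynomial.C (Q.numAttr + 5),
    fun D s hs => ?_⟩
  obtain ⟨r, henc, h0, hinj, himage⟩ := hs.exists_encodes hQ
  obtain ⟨s₁, hr₁, hm₁, h01, h41⟩ := run_mulProg (1 + Q.numAttr) s
  set s₂ := (s₁.setReg 2 0).setReg 5 ((s₁.setReg 2 0).reg 4 + (s₁.setReg 2 0).reg 2) with hs₂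
  have h02 : s₂.reg 0 = D.card := by simp [hs₂, State.setReg, h01, h0]
  have h42 : s₂.reg 4 = D.card * (1 + Q.numAttr) := by simp [hs₂, State.setReg, h41, h0]
  have h52 : s₂.reg 5 = D.card * (1 + Q.numAttr) := by simp [hs₂, State.setReg, h41, h0]
  have hm₂ : s₂.mem = s.mem := hm₁
  have hinit : GreedyInv Q D D.card s₂ :=
    ⟨D.card, r, le_rfl, le_rfl, h02, h42, h52, hm₂ ▸ henc, hinj,
      by rw [himage]; exact ⟨subset_rfl, rfl⟩,
      fun j h1 h2 => by omega⟩
  obtain ⟨s₃, t, hr₃, ht, N, r', -, -, h03, -, -, henc', hinj', hwit, hess⟩ :=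
    Run.exists_loop (GreedyInv Q D)
      (fun s' ⟨_, _, _, _, _, _, h, _⟩ => by simpa using h) (greedy_step hP D) D.card s₂ hinit
  refine ⟨s₃, _, _, .seq hr₁ (.seq (.const _ _ _) (.seq (.add _ _ _ _) hr₃)), ?_,
    henc'.holds h03 hinj', isUnionOfSmallestWitnesses_of_minimal hwit fun f hf => ?_⟩
  · simp only [Polynomial.eval_add, Polynomial.eval_mul, Polynomial.eval_X, Polynomial.eval_C]
    have ht' : t ≤ D.card * (p.eval D.card + (5 * (1 + Q.numAttr) + 9)) + 1 := ht
    omega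
  -- At index `0` the invariant covers all remaining facts, so the witness is minimal.
  · obtain ⟨j, hj, rfl⟩ := Finset.mem_image.1 hf
    exact hess j (Nat.zero_le _) (Finset.mem_range.1 hj)

end SWP

theorem mainTheorem5 (Q : SWP.CQ) (hQ : 0 < Q.numAttr) :
    SWP.IsApproximable Q Q.ratio ∧
      (∀ D D' : SWP.Database Q, SWP.IsUnionOfSmallestWitnesses Q D D' →
        SWP.IsApproxSolution Q (Q.ratio D.card) D D') ∧
      SWP.SolvableInPolyTime Q (SWP.IsUnionOfSmallestWitnesses Q) := by
  have hsolv := SWP.solvableInPolyTime_isUnionOfSmallestWitnesses hQ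
  have happrox : ∀ D D' : SWP.Database Q, SWP.IsUnionOfSmallestWitnesses Q D D' →
      SWP.IsApproxSolution Q (Q.ratio D.card) D D' := fun _ _ h => h.isApproxSolution hQ
  refine ⟨?_, happrox, hsolv⟩
  obtain ⟨P, p, hP⟩ := hsolv
  refine ⟨P, p, fun D s hs => ?_⟩
  obtain ⟨s', n, D', hrun, hn, hholds, hD'⟩ := hP D s hs
  exact ⟨s', n, D', hrun, hn, hholds, happrox D D' hD'⟩
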